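/- Let $H$ be a complex Hilbert space and let $M_0,M_1\in L(H)$ be bounded linear operators such that the range $R(M_0)$ is closed. Let $\mathcal M(z)=zM_0+M_1$ ($z\in\mathbb C$) be the associated linear operator pencil and assume that $\mathcal M$ is regular (of index $0$): there is $\nu\in\mathbb R$ such that $zM_0+M_1$ is boundedly invertible for every $z\in\mathbb C$ with $\operatorname{Re}z>\nu$, and $z\mapsto (zM_0+M_1)^{-1}\in L(H)$ is bounded on $\{\operatorname{Re}z>\nu\}$. Let $\mathrm{IV}=\{x\in H: M_1x\in R(M_0)\}$. In this setting $M_0$, regarded as an operator $M_0|_{\mathrm{IV}}\colon \mathrm{IV}\to R(M_0)$, is continuously invertible; with $M_1|_{\mathrm{IV}}\colon\mathrm{IV}\to R(M_0)$ put $$\sigma_{\mathrm{IV}}(\mathcal M)=\sigma\bigl(-(M_0|_{\mathrm{IV}})^{-1}M_1|_{\mathrm{IV}}\bigr),$$ the spectrum of a bounded operator on $\mathrm{IV}$. For $u_0\in\mathrm{IV}$ let $u(\cdot;u_0)\colon[0,\infty)\to H$ be the unique classical solution of $$M_0u'(t)+M_1u(t)=0\quad(t>0),\qquad u(0)=u_0,$$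 that is, the solution which is continuous on $[0,\infty)$ and continuously differentiable on $(0,\infty)$. A closed subspace $S\subseteq\mathrm{IV}$ is invariant if $u(t;u_0)\in S$ for all $u_0\in S$ and $t>0$. A pair $(S,T)$ of closed invariant subspaces of $\mathrm{IV}$ with $S\cap T=\{0\}$ and $S+T=\mathrm{IV}$ is called a strong exponential dichotomy for $\mathcal M$ if there are constants $\rho>0$, $C\ge0$ and $c>0$ such that for all $t\ge0$ $$|u(t;u_0)|\le Ce^{-\rho t}|u_0|\quad(u_0\in S),\qquad |u(t;u_0)|\ge c\,e^{\rho t}|u_0|\quad(u_0\in T).$$ The pencil $\mathcal M$ admits a strong exponential dichotomy if such a pair exists, and it is strongly exponentially stable if $(\mathrm{IV},\{0\})$ is such a pair. Theorem. (1) $\mathcal M$ admits a strong exponential dichotomy if and only if $\sigma_{\mathrm{IV}}(\mathcal M)\cap i\mathbb R=\emptyset$. (2) $\mathcal M$ is strongly exponentially stable if and only if $\sigma_{\mathrm{IV}}(\mathcal M)\subseteq\{z\in\mathbb C:\operatorname{Re}z<0\}$. -/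

import Mathlib

open Set

noncomputable section

namespace DAE

variable {H : Type*} [NormedAddCommGroup H] [InnerProductSpace ℂ H]

/-- The linear operator pencil `z ↦ z M₀ + M₁` associated with `(M₀, M₁)`. -/
def pencil (M₀ M₁ : H →L[ℂ] H) (z : ℂ) : H →L[ℂ] H := z • M₀ + M₁

/-- The spectrum of the pencil: all `z` such that `0` lies in the spectrum of `z M₀ + M₁`. -/
def pencilSpectrum (M₀ M₁ : H →L[ℂ] H) : Set ℂ :=
  {z | (0 : ℂ) ∈ spectrum ℂ (pencil M₀ M₁ z)}

/-- Regularity (of index 0): some open right half-plane belongs to the resolvent set of the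
pencil, and `z ↦ (z M₀ + M₁)⁻¹` is bounded on it. -/
def IsRegularPencil (M₀ M₁ : H →L[ℂ] H) : Prop :=
  ∃ ν : ℝ, {z : ℂ | ν < z.re} ⊆ (pencilSpectrum M₀ M₁)ᶜ ∧
    ∃ C : ℝ, ∀ z : ℂ, ν < z.re → ‖Ring.inverse (pencil M₀ M₁ z)‖ ≤ C

/-- The space `IV = M₁⁻¹[R(M₀)]` of consistent initial values. -/
def IV (M₀ M₁ : H →L[ℂ] H) : Submodule ℂ H :=
  (LinearMap.range (M₀ : H →ₗ[ℂ] H)).comap (M₁ : H →ₗ[ℂ] H)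

/-- `M₀` as an operator from `IV` to `R(M₀)`. -/
def restrM₀ (M₀ M₁ : H →L[ℂ] H) : IV M₀ M₁ →L[ℂ] LinearMap.range (M₀ : H →ₗ[ℂ] H) :=
  (M₀ ∘L (IV M₀ M₁).subtypeL).codRestrict _ fun x => ⟨(x : H), rfl⟩

/-- `M₁` as an operator from `IV` to `R(M₀)`. -/
def restrM₁ (M₀ M₁ : H →L[ℂ] H) : IV M₀ M₁ →L[ℂ] LinearMap.range (M₀ : H →ₗ[ℂ] H) :=
  (M₁ ∘L (IV M₀ M₁).subtypeL).codRestrict _ fun x => x.2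

/-- The operator `-(M₀|_IV)⁻¹ (M₁|_IV)` on `IV`. If `R(M₀)` is closed and the pencil is regular,
then `M₀ : IV → R(M₀)` is continuously invertible, and `inverse` is its inverse. -/
def generatorIV (M₀ M₁ : H →L[ℂ] H) : IV M₀ M₁ →L[ℂ] IV M₀ M₁ :=
  -((restrM₀ M₀ M₁).inverse ∘L restrM₁ M₀ M₁)

/-- `σ_IV`, the spectrum of `-(M₀|_IV)⁻¹ (M₁|_IV)` on `IV`. -/
def spectrumIV (M₀ M₁ : H →L[ℂ] H) : Set ℂ :=
  spectrum ℂ (generatorIV M₀ M₁)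

/-- `u` (of which only the values on `[0, ∞)` matter) is a classical solution of
`M₀ u'(t) + M₁ u(t) = 0` for `t > 0`, `u(0) = u₀`: it is continuous on `[0, ∞)`, continuously
differentiable on `(0, ∞)`, and satisfies both equations. -/
structure IsStrongSolution (M₀ M₁ : H →L[ℂ] H) (u₀ : H) (u : ℝ → H) : Prop where
  continuousOn : ContinuousOn u (Ici 0)
  contDiffOn : ContDiffOn ℝ 1 u (Ioi 0)
  equation : ∀ t : ℝ, 0 < t → M₀ (deriv u t) + M₁ (u t) = 0
  initial : u 0 = u₀

/-- `S` is invariant under the pencil: the solution starting in a point of `S` stays in `S`. -/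
def IsInvariant (M₀ M₁ : H →L[ℂ] H) (S : Submodule ℂ H) : Prop :=
  ∀ u₀ ∈ S, ∀ u : ℝ → H, IsStrongSolution M₀ M₁ u₀ u → ∀ t : ℝ, 0 < t → u t ∈ S

/-- The closed subspaces `S, T` of `IV` with `S ∔ T = IV` form a strong exponential dichotomy:
both are invariant, solutions decay exponentially on `S` and grow exponentially on `T`. -/
structure IsStrongDichotomy (M₀ M₁ : H →L[ℂ] H) (S T : Submodule ℂ H) : Prop where
  isClosed_left : IsClosed (S : Set H)
  isClosed_right : IsClosed (T : Set H)
  inf_eq : S ⊓ T = ⊥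
  sup_eq : S ⊔ T = IV M₀ M₁
  invariant_left : IsInvariant M₀ M₁ S
  invariant_right : IsInvariant M₀ M₁ T
  bounds : ∃ ρ : ℝ, 0 < ρ ∧ ∃ C : ℝ, 0 ≤ C ∧ ∃ c : ℝ, 0 < c ∧
    (∀ u₀ ∈ S, ∀ u : ℝ → H, IsStrongSolution M₀ M₁ u₀ u →
      ∀ t : ℝ, 0 ≤ t → ‖u t‖ ≤ C * Real.exp (-ρ * t) * ‖u₀‖) ∧
    (∀ u₀ ∈ T, ∀ u : ℝ → H, IsStrongSolution M₀ M₁ u₀ u →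
      ∀ t : ℝ, 0 ≤ t → c * Real.exp (ρ * t) * ‖u₀‖ ≤ ‖u t‖)

/-- The pencil admits a strong exponential dichotomy. -/
def AdmitsStrongDichotomy (M₀ M₁ : H →L[ℂ] H) : Prop :=
  ∃ S T : Submodule ℂ H, IsStrongDichotomy M₀ M₁ S T

/-- Strong exponential stability: a strong exponential dichotomy with `S = IV`, `T = {0}`. -/
def IsStronglyStable (M₀ M₁ : H →L[ℂ] H) : Prop :=
  IsStrongDichotomy M₀ M₁ (IV M₀ M₁) ⊥

end DAE

end

/-!
If the range of `M₀` is closed and the pencil is regular, `M₀ : IV → R(M₀)` is bijective. With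
`R(r) = (r M₀ + M₁)⁻¹` for large real `r`, the identity `r R(r) M₀ y = y - R(r) M₁ y` shows that
`r R(r) M₀ y` stays bounded and hence that `R(r)` tends to zero pointwise on the range of `M₀`.
The first fact bounds `M₀` from below on `IV` (`exists_norm_le_of_mem_IV`), the second makes the
image of `IV` dense in the range of `M₀` (`denseRange_restrM₀`). The pencil thereby reduces to the
bounded operator `G = generatorIV M₀ M₁` on `IV`, and its classical solutions are the orbits of
the group `exp (t G)` (`IsStrongSolution.eq_flow`, `isStrongSolution_flow`).

It remains to compare the asymptotic behaviour of `exp (t G)` with the spectrum of `G`. Decay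
implies that the spectrum lies in the open left half-plane because `exp` maps the spectrum of `G`
into that of `exp G`; for a dichotomy this is applied to the restrictions of `G` and `-G` to the
two invariant subspaces (`re_ne_zero_of_dichotomy`).

For the converse one works in a commutative Banach algebra, the double centralizer of `G`
(`exists_commutative_model`), where spectra are described by characters. If no character takes a
value of modulus one at `b = exp G`, then `(1 - bⁿ)⁻¹` is the mean of the resolvent `(1 - z b)⁻¹`
over the `n`-th roots of unity, that is, a Riemann sum for the Riesz projection. Along the powers
of two these means form a Cauchy sequence, because the resolvent is Lipschitz on the unit circle,
and the limit `p` is idempotent, because `u = (1 - x)⁻¹` and `v = (1 - x²)⁻¹` satisfy `v (2 u - 1)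
= u²` (`exists_idempotent_of_norm_ne_one`). Characters show that `exp(G) p` and `exp(-G) (1 - p)`
have spectral radius less than one, and Gelfand's formula turns this into exponential decay
(`exists_flow_mul_decay`).
-/

open Filter Topology

namespace DAE

/-! ### The one-parameter group of an element of a Banach algebra -/

section Flow

variable {A : Type*} [NormedRing A] [NormedAlgebra ℂ A]

/-- The one-parameter group `t ↦ exp (t a)` generated by an element of a complex Banach algebra,
with real time `t`. -/
noncomputable def flow (a : A) (t : ℝ) : A := NormedSpace.exp ((t : ℂ) • a)

@[simp] theorem flow_zero (a : A) : flow a 0 = 1 := by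
  let _ := NormedAlgebra.restrictScalars ℚ ℂ A
  simp [flow]

theorem flow_neg_left (a : A) (t : ℝ) : flow (-a) t = flow a (-t) := by
  simp [flow]

theorem flow_complex (z : ℂ) (t : ℝ) : flow z t = Complex.exp (t * z) := by
  rw [flow, ← Complex.exp_eq_exp_ℂ, smul_eq_mul]

theorem commute_flow {a b : A} (h : Commute b a) (t : ℝ) : Commute b (flow a t) := by
  let _ := NormedAlgebra.restrictScalars ℚ ℂ A
  exact (h.smul_right (t : ℂ)).exp_right

variable [CompleteSpace A]

theorem flow_add (a : A) (s t : ℝ) : flow a (s + t) = flow a s * flow a t := by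
  let _ := NormedAlgebra.restrictScalars ℚ ℂ A
  rw [flow, flow, flow, ← NormedSpace.exp_add_of_commute, ← add_smul, Complex.ofReal_add]
  exact ((Commute.refl a).smul_left _).smul_right _

@[simp] theorem flow_neg_mul (a : A) (t : ℝ) : flow a (-t) * flow a t = 1 := by
  rw [← flow_add, neg_add_cancel, flow_zero]

@[simp] theorem flow_mul_neg (a : A) (t : ℝ) : flow a t * flow a (-t) = 1 := by
  rw [← flow_add, add_neg_cancel, flow_zero]

theorem flow_natCast (a : A) (n : ℕ) : flow a n = flow a 1 ^ n := by
  induction n with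
  | zero => simp
  | succ n ih => rw [Nat.cast_succ, flow_add, ih, pow_succ]

theorem hasDerivAt_flow (a : A) (t : ℝ) : HasDerivAt (flow a) (a * flow a t) t := by
  have h := hasDerivAt_exp_smul_const' (𝕂 := ℝ) a t
  simp_rw [← Complex.coe_smul] at h
  exact h

theorem continuous_flow (a : A) : Continuous (flow a) :=
  continuous_iff_continuousAt.2 fun t => (hasDerivAt_flow a t).continuousAt

theorem map_flow {B : Type*} [NormedRing B] [NormedAlgebra ℂ B] (f : A →ₐ[ℂ] B)
    (hf : Continuous f) (a : A) (t : ℝ) : f (flow a t) = flow (f a) t := by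
  let _ := NormedAlgebra.restrictScalars ℚ ℂ A
  let _ := NormedAlgebra.restrictScalars ℚ ℂ B
  rw [flow, flow, NormedSpace.map_exp f hf, map_smul]

/-- Exponential decay of the group forces the spectrum of the generator into the open left
half-plane, since `exp (t z)` lies in the spectrum of `exp (t a)`. -/
theorem re_neg_of_flow_decay {a : A} {C ρ : ℝ} (hρ : 0 < ρ)
    (h : ∀ t : ℝ, 0 ≤ t → ‖flow a t‖ ≤ C * Real.exp (-ρ * t)) {z : ℂ} (hz : z ∈ spectrum ℂ a) :
    z.re < 0 := by
  by_contra! hre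
  have key : ∀ t : ℝ, 0 < t → 1 ≤ C * Real.exp (-ρ * t) * ‖(1 : A)‖ := by
    intro t ht
    have ht' : IsUnit (t : ℂ) := by simpa using ht.ne'
    have h1 : (t : ℂ) • z ∈ spectrum ℂ ((t : ℂ) • a) :=
      spectrum.smul_mem_smul_iff (r := ht'.unit) |>.2 hz
    have h2 := spectrum.norm_le_norm_mul_of_mem (spectrum.exp_mem_exp _ h1)
    rw [← Complex.exp_eq_exp_ℂ, Complex.norm_exp] at h2
    have h3 : 0 ≤ ((t : ℂ) • z).re := by simpa using mul_nonneg ht.le hre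
    calc (1 : ℝ) ≤ Real.exp ((t : ℂ) • z).re := Real.one_le_exp h3
      _ ≤ _ := h2
      _ ≤ _ := by gcongr; exact h t ht.le
  have lim : Tendsto (fun t : ℝ => C * Real.exp (-ρ * t) * ‖(1 : A)‖) atTop
      (𝓝 (C * 0 * ‖(1 : A)‖)) := by
    refine (Tendsto.const_mul C ?_).mul_const _
    exact Real.tendsto_exp_atBot.comp (tendsto_id.const_mul_atTop_of_neg (neg_lt_zero.2 hρ))
  have := ge_of_tendsto lim ((eventually_gt_atTop 0).mono key)
  norm_num at this

end Flow

/-! ### Riesz projections and decay in commutative Banach algebras -/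

section Commutative

variable {A : Type*} [NormedCommRing A] [NormedAlgebra ℂ A]

/-- If `z` runs through the `n`-th roots of unity, the mean of `(1 - z b)⁻¹` is `(1 - bⁿ)⁻¹`:
multiplied by `1 - bⁿ`, each summand becomes the geometric sum `∑ j < n, (z b) ^ j`, and all powers
of `b` but the zeroth average out. -/
theorem one_sub_pow_mul_sum_inverse {b : A} {n : ℕ} {ζ : ℂ} (hζ : IsPrimitiveRoot ζ n)
    (hu : ∀ k, IsUnit (1 - ζ ^ k • b)) :
    (1 - b ^ n) * ∑ k ∈ Finset.range n, Ring.inverse (1 - ζ ^ k • b) = (n : ℂ) • (1 : A) := by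
  have h1 : ∀ k, (1 - b ^ n) * Ring.inverse (1 - ζ ^ k • b) =
      ∑ j ∈ Finset.range n, (ζ ^ j) ^ k • b ^ j := by
    intro k
    have hg := mul_neg_geom_sum (ζ ^ k • b) n
    have hp : (ζ ^ k • b) ^ n = b ^ n := by
      rw [smul_pow, ← pow_mul, mul_comm k, pow_mul, hζ.pow_eq_one, one_pow, one_smul]
    rw [hp] at hg
    rw [← hg, mul_comm, ← mul_assoc, Ring.inverse_mul_cancel _ (hu k), one_mul]
    refine Finset.sum_congr rfl fun j _ => ?_
    rw [smul_pow, ← pow_mul, ← pow_mul, mul_comm]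
  rw [Finset.mul_sum, Finset.sum_congr rfl fun k _ => h1 k, Finset.sum_comm]
  simp_rw [← Finset.sum_smul]
  rcases Nat.eq_zero_or_pos n with rfl | hn
  · simp
  rw [Finset.sum_eq_single_of_mem 0 (Finset.mem_range.2 hn)]
  · simp
  · intro j hj hj0
    have hj1 : ζ ^ j ≠ 1 := hζ.pow_ne_one_of_pos_of_lt hj0 (Finset.mem_range.1 hj)
    have : ∑ i ∈ Finset.range n, (ζ ^ j) ^ i = 0 := by
      rw [geom_sum_eq hj1, ← pow_mul, mul_comm, pow_mul, hζ.pow_eq_one]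
      simp
    rw [this, zero_smul]

variable [CompleteSpace A]

/-- Gelfand theory: an element on which no character vanishes is invertible. -/
theorem isUnit_of_forall_character {a : A} (h : ∀ φ : A →ₐ[ℂ] ℂ, φ a ≠ 0) : IsUnit a := by
  by_contra ha
  obtain ⟨f, hf⟩ := WeakDual.CharacterSpace.exists_apply_eq_zero ha
  exact h (WeakDual.CharacterSpace.equivAlgHom f) hf

theorem exists_character_of_mem_spectrum {a : A} {z : ℂ} (hz : z ∈ spectrum ℂ a) :
    ∃ φ : A →ₐ[ℂ] ℂ, φ a = z := by
  obtain ⟨f, hf⟩ := WeakDual.CharacterSpace.mem_spectrum_iff_exists.1 hz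
  exact ⟨WeakDual.CharacterSpace.equivAlgHom f, hf⟩

theorem continuous_character (φ : A →ₐ[ℂ] ℂ) : Continuous φ := φ.toContinuousLinearMap.continuous

theorem character_flow (φ : A →ₐ[ℂ] ℂ) (a : A) (t : ℝ) :
    φ (flow a t) = Complex.exp (t * φ a) := by
  rw [map_flow φ (continuous_character φ), flow_complex]

theorem norm_character_flow_one (φ : A →ₐ[ℂ] ℂ) (a : A) :
    ‖φ (flow a 1)‖ = Real.exp (φ a).re := by
  rw [character_flow, Complex.norm_exp]; simp

theorem isUnit_one_sub_smul {b : A} (hb : ∀ φ : A →ₐ[ℂ] ℂ, ‖φ b‖ ≠ 1) {z : ℂ} (hz : ‖z‖ = 1) :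
    IsUnit (1 - z • b) := by
  refine isUnit_of_forall_character fun φ h => hb φ ?_
  rw [map_sub, map_one, map_smul, sub_eq_zero, smul_eq_mul] at h
  have := congrArg norm h
  rw [norm_one, norm_mul, hz, one_mul] at this
  exact this.symm

theorem isUnit_one_sub_pow {b : A} (hb : ∀ φ : A →ₐ[ℂ] ℂ, ‖φ b‖ ≠ 1) {n : ℕ} (hn : n ≠ 0) :
    IsUnit (1 - b ^ n) := by
  refine isUnit_of_forall_character fun φ h => hb φ ?_
  rw [map_sub, map_one, map_pow, sub_eq_zero] at h
  have := congrArg norm h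
  rw [norm_one, norm_pow] at this
  exact (pow_eq_one_iff_of_nonneg (norm_nonneg _) hn).1 this.symm

theorem inverse_one_sub_pow_eq_mean {b : A} (hb : ∀ φ : A →ₐ[ℂ] ℂ, ‖φ b‖ ≠ 1) {n : ℕ}
    (hn : n ≠ 0) {ζ : ℂ} (hζ : IsPrimitiveRoot ζ n) :
    Ring.inverse (1 - b ^ n) =
      (n : ℂ)⁻¹ • ∑ k ∈ Finset.range n, Ring.inverse (1 - ζ ^ k • b) := by
  have hn' : (n : ℂ) ≠ 0 := Nat.cast_ne_zero.2 hn
  have hz : ∀ k, ‖ζ ^ k‖ = 1 := fun k => by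
    rw [norm_pow, hζ.norm'_eq_one hn, one_pow]
  have h := one_sub_pow_mul_sum_inverse hζ fun k => isUnit_one_sub_smul hb (hz k)
  refine (isUnit_one_sub_pow hb hn).mul_left_cancel ?_
  rw [Ring.mul_inverse_cancel _ (isUnit_one_sub_pow hb hn), mul_smul_comm, h, smul_smul,
    inv_mul_cancel₀ hn', one_smul]

/-- On the unit circle the resolvent is Lipschitz; taking means over the roots of unity, so is
`η ↦ (1 - (η b)ⁿ)⁻¹`, with a constant independent of `n`. -/
theorem exists_lipschitz_inverse_one_sub_pow {b : A} (hb : ∀ φ : A →ₐ[ℂ] ℂ, ‖φ b‖ ≠ 1) :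
    ∃ L : ℝ, ∀ n : ℕ, n ≠ 0 → ∀ η : ℂ, ‖η‖ = 1 →
      ‖Ring.inverse (1 - (η • b) ^ n) - Ring.inverse (1 - b ^ n)‖ ≤ L * ‖η - 1‖ := by
  obtain ⟨M, hM⟩ : ∃ M, ∀ z ∈ Metric.sphere (0 : ℂ) 1, ‖Ring.inverse (1 - z • b)‖ ≤ M := by
    refine (isCompact_sphere _ _).exists_bound_of_continuousOn fun z hz => ?_
    have hz' : ‖z‖ = 1 := by simpa using hz
    have hc := NormedRing.inverse_continuousAt (isUnit_one_sub_smul hb hz').unit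
    refine ContinuousAt.continuousWithinAt ?_
    refine ContinuousAt.comp (f := fun z : ℂ => 1 - z • b) (g := Ring.inverse) hc ?_
    fun_prop
  have hM0 : 0 ≤ M := (norm_nonneg _).trans (hM 1 (by simp))
  refine ⟨M * ‖b‖ * M, fun n hn η hη => ?_⟩
  have hζ := Complex.isPrimitiveRoot_exp n hn
  set ζ := Complex.exp (2 * Real.pi * Complex.I / n)
  have hz : ∀ k, ‖ζ ^ k‖ = 1 := fun k => by rw [norm_pow, hζ.norm'_eq_one hn, one_pow]
  have hηb : ∀ φ : A →ₐ[ℂ] ℂ, ‖φ (η • b)‖ ≠ 1 := fun φ => by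
    rw [map_smul, norm_smul, hη, one_mul]; exact hb φ
  rw [inverse_one_sub_pow_eq_mean hb hn hζ, inverse_one_sub_pow_eq_mean hηb hn hζ, ← smul_sub,
    ← Finset.sum_sub_distrib, norm_smul, norm_inv, Complex.norm_natCast]
  have hn' : (0 : ℝ) < n := Nat.cast_pos.2 (Nat.pos_of_ne_zero hn)
  rw [inv_mul_le_iff₀ hn']
  refine (norm_sum_le_of_le _ (f := fun k => _) (n := fun _ => M * ‖b‖ * M * ‖η - 1‖)
    fun k _ => ?_).trans (by simp)
  have hu1 : IsUnit (1 - ζ ^ k • b) := isUnit_one_sub_smul hb (hz k)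
  have hzη : ‖ζ ^ k * η‖ = 1 := by rw [norm_mul, hz, hη, one_mul]
  have hu2 : IsUnit (1 - (ζ ^ k * η) • b) := isUnit_one_sub_smul hb hzη
  rw [smul_smul]
  have e : Ring.inverse (1 - (ζ ^ k * η) • b) - Ring.inverse (1 - ζ ^ k • b) =
      (ζ ^ k * (η - 1)) •
        (Ring.inverse (1 - (ζ ^ k * η) • b) * b * Ring.inverse (1 - ζ ^ k • b)) := by
    refine hu2.mul_left_cancel (hu1.mul_left_cancel ?_)
    have e1 := Ring.mul_inverse_cancel _ hu1
    have e2 := Ring.mul_inverse_cancel _ hu2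
    set x := Ring.inverse (1 - ζ ^ k • b)
    set y := Ring.inverse (1 - (ζ ^ k * η) • b)
    calc (1 - ζ ^ k • b) * ((1 - (ζ ^ k * η) • b) * (y - x))
        = (1 - ζ ^ k • b) * ((1 - (ζ ^ k * η) • b) * y)
          - (1 - (ζ ^ k * η) • b) * ((1 - ζ ^ k • b) * x) := by ring
      _ = (ζ ^ k * (η - 1)) • b := by rw [e1, e2, mul_sub, sub_smul]; simp
      _ = (ζ ^ k * (η - 1)) •
          (((1 - (ζ ^ k * η) • b) * y) * b * ((1 - ζ ^ k • b) * x)) := by rw [e1, e2]; simp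
      _ = _ := by simp only [mul_smul_comm]; congr 1; ring
  rw [e, norm_smul, norm_mul, hz, one_mul, mul_comm]
  gcongr
  refine (norm_mul_le _ _).trans ?_
  gcongr
  · refine (norm_mul_le _ _).trans ?_
    gcongr
    exact hM _ (by simpa using hzη)
  · exact hM _ (by simpa using hz k)

/-- The Riesz projection of `b` for the open unit disc, as the limit of `(1 - bⁿ)⁻¹` along the
powers of two. -/
theorem exists_idempotent_of_norm_ne_one {b : A} (hb : ∀ φ : A →ₐ[ℂ] ℂ, ‖φ b‖ ≠ 1) :
    ∃ p : A, p * p = p ∧ ∀ φ : A →ₐ[ℂ] ℂ, ‖φ b‖ < 1 ∧ φ p = 1 ∨ 1 < ‖φ b‖ ∧ φ p = 0 := by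
  obtain ⟨L, hL⟩ := exists_lipschitz_inverse_one_sub_pow hb
  have h2 : ∀ k : ℕ, 2 ^ k ≠ 0 := fun k => pow_ne_zero _ two_ne_zero
  set u : ℕ → A := fun k => Ring.inverse (1 - b ^ 2 ^ k) with hu
  have hu1 : ∀ k, (1 - b ^ 2 ^ k) * u k = 1 := fun k =>
    Ring.mul_inverse_cancel _ (isUnit_one_sub_pow hb (h2 k))
  have hsq : ∀ k, b ^ 2 ^ (k + 1) = b ^ 2 ^ k * b ^ 2 ^ k := fun k => by
    rw [← pow_add, pow_succ, mul_two]
  have hdist : ∀ k, dist (u k) (u (k + 1)) ≤ (|L| / 2 * Real.pi) * (1 / 2) ^ k := by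
    intro k
    -- `(η b) ^ 2 ^ k = - b ^ 2 ^ k` for this `η`
    set θ : ℝ := Real.pi / 2 ^ k
    set η : ℂ := Complex.exp (Complex.I * θ) with hη
    have hη1 : ‖η‖ = 1 := by rw [hη, mul_comm, Complex.norm_exp_ofReal_mul_I]
    have hηn : η ^ 2 ^ k = -1 := by
      rw [hη, ← Complex.exp_nat_mul, ← Complex.exp_pi_mul_I]
      congr 1
      have : (2 : ℂ) ^ k ≠ 0 := pow_ne_zero _ two_ne_zero
      simp only [θ]
      push_cast
      field_simp
    set v := Ring.inverse (1 - (η • b) ^ 2 ^ k) with hv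
    have hηb : ∀ φ : A →ₐ[ℂ] ℂ, ‖φ (η • b)‖ ≠ 1 := fun φ => by
      rw [map_smul, norm_smul, hη1, one_mul]; exact hb φ
    have hv1 : (1 + b ^ 2 ^ k) * v = 1 := by
      have := Ring.mul_inverse_cancel _ (isUnit_one_sub_pow hηb (h2 k))
      rwa [← hv, smul_pow, hηn, neg_one_smul, sub_neg_eq_add] at this
    have e : u (k + 1) - u k = (1 / 2 : ℂ) • (v - u k) := by
      refine (isUnit_one_sub_pow hb (h2 (k + 1))).mul_left_cancel ?_
      rw [mul_sub, hu1, mul_smul_comm, hsq]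
      have e1 := hu1 k
      have : (1 - b ^ 2 ^ k * b ^ 2 ^ k) * (v - u k) = (2 : ℂ) • (-b ^ 2 ^ k) := by
        rw [two_smul]
        linear_combination (1 - b ^ 2 ^ k) * hv1 - (1 + b ^ 2 ^ k) * e1
      rw [this, smul_smul]
      norm_num
      linear_combination (-1 - b ^ 2 ^ k) * e1
    rw [dist_eq_norm, norm_sub_rev, e, norm_smul]
    have hθ : ‖η - 1‖ ≤ Real.pi * (1 / 2) ^ k := by
      refine Real.norm_exp_I_mul_ofReal_sub_one_le.trans ?_
      rw [Real.norm_of_nonneg (by positivity), one_div, inv_pow]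
      rfl
    calc ‖(1 / 2 : ℂ)‖ * ‖v - u k‖ ≤ (1 / 2) * (|L| * (Real.pi * (1 / 2) ^ k)) := by
          have h3 := (hL _ (h2 k) η hη1).trans
            ((mul_le_mul_of_nonneg_right (le_abs_self L) (norm_nonneg _)).trans
              (mul_le_mul_of_nonneg_left hθ (abs_nonneg L)))
          have : ‖(1 / 2 : ℂ)‖ = 1 / 2 := by norm_num
          rw [this]
          gcongr
      _ = _ := by ring
  obtain ⟨p, hp⟩ := cauchySeq_tendsto_of_complete
    (cauchySeq_of_le_geometric _ _ (by norm_num) hdist)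
  refine ⟨p, ?_, fun φ => ?_⟩
  · -- pass to the limit in `u (k + 1) * (2 u k - 1) = (u k)²`
    have hp' := hp.comp (tendsto_add_atTop_nat 1)
    have hrel : ∀ k, u (k + 1) * (u k + u k - 1) = u k * u k := by
      intro k
      refine (isUnit_one_sub_pow hb (h2 (k + 1))).mul_left_cancel ?_
      have e1 := hu1 k
      rw [← mul_assoc, hu1, hsq]
      linear_combination (1 - (1 + b ^ 2 ^ k) * u k) * e1
    have l1 : Tendsto (fun k => u (k + 1) * (u k + u k - 1)) atTop (𝓝 (p * (p + p - 1))) :=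
      hp'.mul ((hp.add hp).sub_const 1)
    have l2 : Tendsto (fun k => u (k + 1) * (u k + u k - 1)) atTop (𝓝 (p * p)) := by
      simp_rw [hrel]; exact hp.mul hp
    have := tendsto_nhds_unique l1 l2
    linear_combination this
  · have hφ : Tendsto (fun k => φ (u k)) atTop (𝓝 (φ p)) :=
      ((continuous_character φ).tendsto p).comp hp
    have hφu : ∀ k, φ (u k) = (1 - φ b ^ 2 ^ k)⁻¹ := fun k => by
      have := congrArg φ (hu1 k)
      rw [map_mul, map_sub, map_one, map_pow] at this
      exact eq_inv_of_mul_eq_one_right this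
    simp_rw [hφu] at hφ
    have h2t : Tendsto (fun k : ℕ => 2 ^ k) atTop atTop :=
      tendsto_pow_atTop_atTop_of_one_lt (α := ℕ) one_lt_two
    rcases lt_or_gt_of_ne (hb φ) with h | h
    · refine Or.inl ⟨h, tendsto_nhds_unique hφ ?_⟩
      have := (tendsto_pow_atTop_nhds_zero_of_norm_lt_one h).comp h2t
      have := (this.const_sub 1).inv₀ (by simp)
      simpa using this
    · refine Or.inr ⟨h, tendsto_nhds_unique hφ ?_⟩
      refine tendsto_inv₀_cobounded.comp ?_
      rw [← tendsto_norm_atTop_iff_cobounded]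
      have h3 : Tendsto (fun k : ℕ => ‖φ b‖ ^ 2 ^ k - 1) atTop atTop :=
        tendsto_atTop_add_const_right _ _ ((tendsto_pow_atTop_atTop_of_one_lt h).comp h2t)
      refine tendsto_atTop_mono (fun k => ?_) h3
      have := norm_sub_norm_le (φ b ^ 2 ^ k) 1
      rw [norm_pow, norm_one, norm_sub_rev] at this
      exact this

/-- The spectral projection of `a` for the open left half-plane: since `exp` maps the open left
half-plane into the open unit disc, it is the Riesz projection of `exp a` for the disc. -/
theorem exists_idempotent_of_re_ne_zero {a : A} (ha : ∀ φ : A →ₐ[ℂ] ℂ, (φ a).re ≠ 0) :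
    ∃ p : A, p * p = p ∧ ∀ φ : A →ₐ[ℂ] ℂ, (φ a).re < 0 ∧ φ p = 1 ∨ 0 < (φ a).re ∧ φ p = 0 := by
  obtain ⟨p, hp, h⟩ := exists_idempotent_of_norm_ne_one (b := flow a 1) fun φ h => ha φ <| by
    rwa [norm_character_flow_one, Real.exp_eq_one_iff] at h
  refine ⟨p, hp, fun φ => ?_⟩
  simpa only [norm_character_flow_one, Real.exp_lt_one_iff, Real.one_lt_exp_iff] using h φ

/-- By Gelfand's formula the powers of an element on which all characters are less than one in
modulus become small. -/
theorem exists_pow_norm_lt_one {c : A} (hc : ∀ φ : A →ₐ[ℂ] ℂ, ‖φ c‖ < 1) :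
    ∃ N : ℕ, N ≠ 0 ∧ ‖c ^ N‖ < 1 := by
  rcases subsingleton_or_nontrivial A with _ | _
  · exact ⟨1, one_ne_zero, by simp [Subsingleton.elim (c ^ 1) 0]⟩
  have hr : spectralRadius ℂ c < ((1 : NNReal) : ENNReal) := by
    refine spectrum.spectralRadius_lt_of_forall_lt c fun z hz => ?_
    obtain ⟨φ, rfl⟩ := exists_character_of_mem_spectrum hz
    exact hc φ
  have ht := spectrum.pow_nnnorm_pow_one_div_tendsto_nhds_spectralRadius c
  obtain ⟨N, hN, hN0⟩ := ((ht.eventually_lt_const hr).and (eventually_ne_atTop 0)).exists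
  refine ⟨N, hN0, ?_⟩
  by_contra! h1
  have : (1 : ENNReal) ≤ (‖c ^ N‖₊ : ENNReal) := by exact_mod_cast h1
  exact absurd hN (not_lt.2 (by simpa using ENNReal.one_le_rpow this (by positivity)))

/-- On the range of an idempotent `p` the group generated by `a` decays exponentially as soon as
`Re φ(a) < 0` for every character `φ` not vanishing at `p`. -/
theorem exists_flow_mul_decay {a p : A} (hp : p * p = p)
    (h : ∀ φ : A →ₐ[ℂ] ℂ, φ p = 0 ∨ (φ a).re < 0) :
    ∃ ρ : ℝ, 0 < ρ ∧ ∃ C : ℝ, 0 ≤ C ∧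
      ∀ t : ℝ, 0 ≤ t → ‖flow a t * p‖ ≤ C * Real.exp (-ρ * t) := by
  obtain ⟨N, hN0, hN⟩ := exists_pow_norm_lt_one (c := flow a 1 * p) fun φ => by
    rw [map_mul, norm_mul, norm_character_flow_one]
    rcases h φ with h | h
    · simp [h]
    · have hφ : φ p * φ p = φ p := by rw [← map_mul, hp]
      have hle : ‖φ p‖ ≤ 1 := by
        by_cases h0 : φ p = 0
        · simp [h0]
        · rw [mul_right_cancel₀ h0 (hφ.trans (one_mul _).symm), norm_one]
      calc Real.exp (φ a).re * ‖φ p‖ ≤ Real.exp (φ a).re * 1 := by gcongr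
        _ < 1 := by rw [mul_one]; exact Real.exp_lt_one_iff.2 h
  set c := flow a 1 * p
  set q := max ‖c ^ N‖ (1 / 2) with hq
  have hq0 : 0 < q := lt_max_of_lt_right (by norm_num)
  have hq1 : q < 1 := max_lt hN (by norm_num)
  have hNpos : (0 : ℝ) < N := Nat.cast_pos.2 (Nat.pos_of_ne_zero hN0)
  obtain ⟨K, hK⟩ := (isCompact_Icc (a := (0 : ℝ)) (b := N)).exists_bound_of_continuousOn
    (f := fun s => flow a s * p) ((continuous_flow a).mul continuous_const).continuousOn
  have hK0 : 0 ≤ K := (norm_nonneg _).trans (hK 0 ⟨le_rfl, hNpos.le⟩)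
  have hpp : ∀ m : ℕ, p * p ^ m = p := fun m => by
    induction m with
    | zero => simp
    | succ m ih => rw [pow_succ, ← mul_assoc, ih, hp]
  have hlog : Real.log q < 0 := Real.log_neg hq0 hq1
  refine ⟨-Real.log q / N, div_pos (neg_pos.2 hlog) hNpos, K * ‖(1 : A)‖ / q + K / q,
    by positivity, fun t ht => ?_⟩
  set k := ⌊t / N⌋₊
  have hk1 : (k : ℝ) * N ≤ t := (le_div_iff₀ hNpos).1 (Nat.floor_le (by positivity))
  have hk2 : t < (k + 1) * N := (div_lt_iff₀ hNpos).1 (Nat.lt_floor_add_one _)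
  have hdecomp : flow a t * p = flow a (t - k * N) * p * (c ^ N) ^ k := by
    have h1 : t = (t - k * N) + ((N * k : ℕ) : ℝ) := by push_cast; ring
    conv_lhs => rw [h1, flow_add, flow_natCast]
    rw [← pow_mul, mul_pow]
    calc _ = flow a (t - k * N) * flow a 1 ^ (N * k) * (p * p ^ (N * k)) := by rw [hpp]
      _ = _ := by ring
  have hqk : q ^ k ≤ Real.exp (-(-Real.log q / N) * t) / q := by
    rw [le_div_iff₀ hq0, ← pow_succ]
    have : Real.exp (-(-Real.log q / N) * t) = q ^ (t / N) := by
      rw [Real.rpow_def_of_pos hq0]; congr 1; ring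
    rw [this, ← Real.rpow_natCast]
    refine Real.rpow_le_rpow_of_exponent_ge hq0 hq1.le ?_
    rw [div_le_iff₀ hNpos]
    push_cast
    exact hk2.le
  have hs : ‖flow a (t - k * N) * p‖ ≤ K := hK _ ⟨by linarith, by linarith⟩
  set E := Real.exp (-(-Real.log q / N) * t)
  have hE : 0 < E := Real.exp_pos _
  have hck : ‖(c ^ N) ^ k‖ ≤ (‖(1 : A)‖ + 1) * q ^ k := by
    rcases Nat.eq_zero_or_pos k with h0 | h0
    · rw [h0]; simp
    · refine (norm_pow_le' _ h0).trans ?_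
      have hcq : ‖c ^ N‖ ≤ q := le_max_left _ _
      refine (pow_le_pow_left₀ (norm_nonneg _) hcq k).trans ?_
      exact le_mul_of_one_le_left (by positivity) (by linarith [norm_nonneg (1 : A)])
  calc ‖flow a t * p‖ ≤ ‖flow a (t - k * N) * p‖ * ‖(c ^ N) ^ k‖ := by
        rw [hdecomp]; exact norm_mul_le _ _
    _ ≤ K * ((‖(1 : A)‖ + 1) * (E / q)) := by gcongr; exact hck.trans (by gcongr)
    _ = _ := by ring

end Commutative

/-! ### Reduction to commutative Banach algebras -/

section Transfer

universe u

/-- Every element of a complex Banach algebra lies in a closed commutative subalgebra without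
gaining spectrum: the double centralizer is commutative and closed under inverses. -/
theorem exists_commutative_model {R : Type u} [NormedRing R] [NormedAlgebra ℂ R] [CompleteSpace R]
    (a : R) : ∃ (B : Type u) (_ : NormedCommRing B) (_ : NormedAlgebra ℂ B) (_ : CompleteSpace B)
      (f : B →ₐ[ℂ] R) (b : B), Isometry f ∧ f b = a ∧ spectrum ℂ b ⊆ spectrum ℂ a := by
  set D : Subalgebra ℂ R :=
    Subalgebra.centralizer ℂ (Subalgebra.centralizer ℂ ({a} : Set R) : Set R) with hD
  have haD : a ∈ D := fun g hg => (hg a rfl).symm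
  have hDa : ∀ x ∈ D, x ∈ Subalgebra.centralizer ℂ ({a} : Set R) := by
    intro x hx g hg
    rw [mem_singleton_iff] at hg
    subst hg
    exact hx g fun g' hg' => by rw [mem_singleton_iff] at hg'; rw [hg']
  have hcomm : ∀ x y : D, x * y = y * x := fun x y => Subtype.ext (y.2 x (hDa x x.2))
  have hclosed : IsClosed (D : Set R) := Set.isClosed_centralizer _
  let _ : NormedCommRing D := { (inferInstance : NormedRing D) with mul_comm := hcomm }
  refine ⟨D, inferInstance, Subalgebra.toNormedAlgebra D, hclosed.completeSpace_coe, D.val,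
    ⟨a, haD⟩, isometry_subtype_coe, rfl, ?_⟩
  intro z hz hu
  refine hz ?_
  set x : R := algebraMap ℂ R z - a with hx
  obtain ⟨v, hv⟩ := (show IsUnit x from hu)
  have hxD : x ∈ D := D.sub_mem (D.algebraMap_mem z) haD
  have hinv : (↑v⁻¹ : R) ∈ D := by
    intro g hg
    have h : Commute g x := hxD g hg
    rw [← hv] at h
    exact h.units_inv_right
  refine IsUnit.of_mul_eq_one ⟨(↑v⁻¹ : R), hinv⟩ (Subtype.ext ?_)
  change x * (↑v⁻¹ : R) = 1
  rw [← hv, Units.mul_inv]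

end Transfer

/-! ### Groups of bounded operators -/

section Operator

variable {X : Type*} [NormedAddCommGroup X] [NormedSpace ℂ X] [CompleteSpace X]

/-- If the spectrum of the generator lies in the open left half-plane, then the group decays
exponentially. -/
theorem exists_flow_decay {G : X →L[ℂ] X} (hG : ∀ z ∈ spectrum ℂ G, z.re < 0) :
    ∃ ρ : ℝ, 0 < ρ ∧ ∃ C : ℝ, 0 ≤ C ∧ ∀ t : ℝ, 0 ≤ t → ‖flow G t‖ ≤ C * Real.exp (-ρ * t) := by
  obtain ⟨B, _, _, _, f, b, hf, rfl, hs⟩ := exists_commutative_model G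
  obtain ⟨ρ, hρ, C, hC, h⟩ := exists_flow_mul_decay (a := b) (p := 1) (one_mul 1)
    fun φ => Or.inr (hG _ (hs (AlgHom.apply_mem_spectrum φ b)))
  refine ⟨ρ, hρ, C, hC, fun t ht => ?_⟩
  rw [← map_flow f hf.continuous, hf.norm_map_of_map_zero (map_zero f), ← mul_one (flow b t)]
  exact h t ht

/-- If the spectrum of the generator misses the imaginary axis, then the spectral projection for the
left half-plane splits the group into a decaying and a growing part. -/
theorem exists_projection_flow_decay {G : X →L[ℂ] X} (hG : ∀ z ∈ spectrum ℂ G, z.re ≠ 0) :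
    ∃ p : X →L[ℂ] X, p * p = p ∧ Commute p G ∧ ∃ ρ : ℝ, 0 < ρ ∧ ∃ C : ℝ, 0 < C ∧ ∀ t : ℝ, 0 ≤ t →
      ‖flow G t * p‖ ≤ C * Real.exp (-ρ * t) ∧
      ‖flow G (-t) * (1 - p)‖ ≤ C * Real.exp (-ρ * t) := by
  obtain ⟨B, _, _, _, f, b, hf, rfl, hs⟩ := exists_commutative_model G
  obtain ⟨p, hp, hφ⟩ := exists_idempotent_of_re_ne_zero (a := b)
    fun φ => hG _ (hs (AlgHom.apply_mem_spectrum φ b))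
  obtain ⟨ρ₁, hρ₁, C₁, hC₁, h₁⟩ := exists_flow_mul_decay (a := b) hp fun φ => by
    rcases hφ φ with h | h
    · exact Or.inr h.1
    · exact Or.inl h.2
  have hq : (1 - p) * (1 - p) = 1 - p := by linear_combination hp
  obtain ⟨ρ₂, hρ₂, C₂, hC₂, h₂⟩ := exists_flow_mul_decay (a := -b) hq fun φ => by
    rcases hφ φ with h | h
    · exact Or.inl (by simp [h.2])
    · exact Or.inr (by simpa using h.1)
  have hn : ∀ x, ‖f x‖ = ‖x‖ := fun x => hf.norm_map_of_map_zero (map_zero f) x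
  refine ⟨f p, by rw [← map_mul, hp], (Commute.all p b).map f, min ρ₁ ρ₂, lt_min hρ₁ hρ₂,
    C₁ + C₂ + 1, by positivity, fun t ht => ?_⟩
  rw [← map_flow f hf.continuous, ← map_flow f hf.continuous, ← map_one f, ← map_sub, ← map_mul,
    ← map_mul, hn, hn]
  constructor
  · refine (h₁ t ht).trans ?_
    gcongr
    · linarith
    · exact min_le_left _ _
  · rw [← flow_neg_left]
    refine (h₂ t ht).trans ?_
    gcongr
    · linarith
    · exact min_le_right _ _

theorem re_neg_of_norm_flow_apply_le {G : X →L[ℂ] X} {C ρ : ℝ} (hρ : 0 < ρ) (hC : 0 ≤ C)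
    (h : ∀ x, ∀ t : ℝ, 0 ≤ t → ‖flow G t x‖ ≤ C * Real.exp (-ρ * t) * ‖x‖) {z : ℂ}
    (hz : z ∈ spectrum ℂ G) : z.re < 0 :=
  re_neg_of_flow_decay hρ
    (fun t ht => ContinuousLinearMap.opNorm_le_bound _ (by positivity) fun x => h x t ht) hz

omit [CompleteSpace X] in
theorem hasDerivAt_clm_apply {A : ℝ → X →L[ℂ] X} {A' : X →L[ℂ] X} {u : ℝ → X} {u' : X} {t : ℝ}
    (hA : HasDerivAt A A' t) (hu : HasDerivAt u u' t) :
    HasDerivAt (fun s => A s (u s)) (A' (u t) + A t u') t :=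
  ((ContinuousLinearMap.restrictScalarsL ℂ X X ℝ ℝ).hasFDerivAt.comp_hasDerivAt t hA).clm_apply hu

theorem hasDerivAt_flow_apply (G : X →L[ℂ] X) (x : X) (t : ℝ) :
    HasDerivAt (fun s => flow G s x) (G (flow G t x)) t := by
  simpa using hasDerivAt_clm_apply (hasDerivAt_flow G t) (hasDerivAt_const t x)

/-- Solutions of `u' = G u` on `(0, ∞)` which are continuous at `0` are given by the group. -/
theorem eq_flow_of_hasDerivAt (G : X →L[ℂ] X) {u : ℝ → X} (hc : ContinuousOn u (Ici 0))
    (hd : ∀ t, 0 < t → HasDerivAt u (G (u t)) t) {t : ℝ} (ht : 0 ≤ t) : u t = flow G t (u 0) := by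
  set v : ℝ → X := fun s => flow G (-s) (u s) with hv
  have hvd : ∀ s, 0 < s → HasDerivAt v 0 s := by
    intro s hs
    have h1 := (hasDerivAt_flow G (-s)).scomp s (hasDerivAt_neg s)
    have h2 := hasDerivAt_clm_apply h1 (hd s hs)
    have hcomm : G * flow G (-s) = flow G (-s) * G := commute_flow (Commute.refl G) (-s)
    refine h2.congr_deriv ?_
    rw [hcomm]
    simp
  have hvc : ContinuousOn v (Ici 0) :=
    ((continuous_flow G).comp continuous_neg).continuousOn.clm_apply hc
  have hconst : v t = v 0 := by
    rcases ht.eq_or_lt with rfl | ht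
    · rfl
    have h1 : ∀ s ∈ Ioc 0 t, v s = v t := by
      intro s hs
      refine (constant_of_has_deriv_right_zero (f := v) (a := s) (b := t) ?_ ?_ t
        ⟨hs.2, le_rfl⟩).symm
      · exact hvc.mono fun r hr => hs.1.le.trans hr.1
      · exact fun r hr => (hvd r (hs.1.trans_le hr.1)).hasDerivWithinAt
    have h2 : Tendsto v (𝓝[>] 0) (𝓝 (v 0)) :=
      (hvc 0 self_mem_Ici).mono_left (nhdsWithin_mono _ Ioi_subset_Ici_self)
    refine tendsto_nhds_unique (tendsto_const_nhds.congr' ?_) h2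
    filter_upwards [Ioc_mem_nhdsGT ht] with s hs using (h1 s hs).symm
  have h3 : flow G t (v t) = u t := by
    rw [hv, ← mul_apply_eq_comp, flow_mul_neg, one_apply_eq_self]
  rw [← h3, hconst, hv]
  simp

/-- A closed subspace invariant under the group is invariant under its generator. -/
theorem apply_mem_of_flow_mem (G : X →L[ℂ] X) {S : Submodule ℂ X} (hS : IsClosed (S : Set X))
    (h : ∀ x ∈ S, ∀ t : ℝ, 0 < t → flow G t x ∈ S) : ∀ x ∈ S, G x ∈ S := by
  intro x hx
  have hd := (hasDerivAt_flow_apply G x 0).tendsto_slope_zero_right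
  rw [flow_zero, one_apply_eq_self] at hd
  refine hS.mem_of_tendsto hd ?_
  filter_upwards [self_mem_nhdsWithin] with t ht
  rw [zero_add]
  exact (S.restrictScalars ℝ).smul_mem _ (S.sub_mem (h x hx t ht) hx)

theorem coe_flow_restrict (G : X →L[ℂ] X) {S : Submodule ℂ X} [CompleteSpace S]
    (h : ∀ x ∈ S, G x ∈ S) (x : S) {t : ℝ} (ht : 0 ≤ t) :
    (flow (G.restrict h) t x : X) = flow G t x := by
  have hd : ∀ s, HasDerivAt (fun s => (flow (G.restrict h) s x : X))
      (G (flow (G.restrict h) s x : X)) s := fun s =>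
    ((S.subtypeL.restrictScalars ℝ).hasFDerivAt.comp_hasDerivAt s
      (hasDerivAt_flow_apply (G.restrict h) x s))
  have := eq_flow_of_hasDerivAt G (u := fun s => (flow (G.restrict h) s x : X))
    (fun s _ => (hd s).continuousAt.continuousWithinAt) (fun s _ => hd s) ht
  simpa using this

/-- If the restrictions of `z - G` to two complementary invariant subspaces are invertible, then
so is `z - G`. -/
theorem isUnit_of_isUnit_restrict {G : X →L[ℂ] X} {S T : Submodule ℂ X} (hST : IsCompl S T)
    (hS : ∀ x ∈ S, G x ∈ S) (hT : ∀ x ∈ T, G x ∈ T) {z : ℂ}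
    (h₁ : IsUnit (algebraMap ℂ (S →L[ℂ] S) z - G.restrict hS))
    (h₂ : IsUnit (algebraMap ℂ (T →L[ℂ] T) z - G.restrict hT)) :
    IsUnit (algebraMap ℂ (X →L[ℂ] X) z - G) := by
  obtain ⟨⟨f, f', hf, hf'⟩, rfl : f = _⟩ := h₁
  obtain ⟨⟨g, g', hg, hg'⟩, rfl : g = _⟩ := h₂
  have hS1 : ∀ x : S, ((algebraMap ℂ (S →L[ℂ] S) z - G.restrict hS) x : X) = z • (x : X) - G x :=
    fun x => rfl
  have hT1 : ∀ x : T, ((algebraMap ℂ (T →L[ℂ] T) z - G.restrict hT) x : X) = z • (x : X) - G x :=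
    fun x => rfl
  have hX1 : ∀ x, (algebraMap ℂ (X →L[ℂ] X) z - G) x = z • x - G x := fun x => rfl
  rw [ContinuousLinearMap.isUnit_iff_bijective]
  constructor
  · rw [injective_iff_map_eq_zero]
    intro x hx
    obtain ⟨s, hs, t, ht, rfl⟩ :=
      Submodule.mem_sup.1 (hST.sup_eq_top ▸ Submodule.mem_top : x ∈ S ⊔ T)
    rw [hX1, map_add, smul_add] at hx
    have h1 : z • s - G s ∈ S := S.sub_mem (S.smul_mem z hs) (hS s hs)
    have h2 : z • t - G t ∈ T := T.sub_mem (T.smul_mem z ht) (hT t ht)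
    have h3 : z • s - G s = -(z • t - G t) := by
      rw [eq_neg_iff_add_eq_zero, ← hx]; abel
    have h4 : z • s - G s = 0 :=
      Submodule.disjoint_def.1 hST.disjoint _ h1 (h3 ▸ T.neg_mem h2)
    have h5 : z • t - G t = 0 := by rw [← neg_eq_zero, ← h3, h4]
    have hs0 : (⟨s, hs⟩ : S) = 0 := by
      have := congrArg (fun k => k ⟨s, hs⟩) hf'
      have h6 : (algebraMap ℂ (S →L[ℂ] S) z - G.restrict hS) ⟨s, hs⟩ = 0 := Subtype.ext h4
      simpa [mul_apply_eq_comp, h6] using this.symm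
    have ht0 : (⟨t, ht⟩ : T) = 0 := by
      have := congrArg (fun k => k ⟨t, ht⟩) hg'
      have h6 : (algebraMap ℂ (T →L[ℂ] T) z - G.restrict hT) ⟨t, ht⟩ = 0 := Subtype.ext h5
      simpa [mul_apply_eq_comp, h6] using this.symm
    rw [show s = 0 from congrArg Subtype.val hs0, show t = 0 from congrArg Subtype.val ht0,
      add_zero]
  · intro y
    obtain ⟨s, hs, t, ht, rfl⟩ :=
      Submodule.mem_sup.1 (hST.sup_eq_top ▸ Submodule.mem_top : y ∈ S ⊔ T)
    refine ⟨f' ⟨s, hs⟩ + g' ⟨t, ht⟩, ?_⟩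
    have h1 := congrArg (fun k => ((k ⟨s, hs⟩ : S) : X)) hf
    have h2 := congrArg (fun k => ((k ⟨t, ht⟩ : T) : X)) hg
    rw [map_add]
    exact congrArg₂ (· + ·) h1 h2

/-- The spectrum of the generator of a dichotomous group misses the imaginary axis. -/
theorem re_ne_zero_of_dichotomy {G : X →L[ℂ] X} {S T : Submodule ℂ X} (hST : IsCompl S T)
    (hSc : IsClosed (S : Set X)) (hTc : IsClosed (T : Set X))
    (hS : ∀ x ∈ S, ∀ t : ℝ, 0 < t → flow G t x ∈ S)
    (hT : ∀ x ∈ T, ∀ t : ℝ, 0 < t → flow G t x ∈ T)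
    {ρ C c : ℝ} (hρ : 0 < ρ) (hC : 0 ≤ C) (hc : 0 < c)
    (hS' : ∀ x ∈ S, ∀ t : ℝ, 0 ≤ t → ‖flow G t x‖ ≤ C * Real.exp (-ρ * t) * ‖x‖)
    (hT' : ∀ x ∈ T, ∀ t : ℝ, 0 ≤ t → c * Real.exp (ρ * t) * ‖x‖ ≤ ‖flow G t x‖)
    {z : ℂ} (hz : z ∈ spectrum ℂ G) : z.re ≠ 0 := by
  have := hSc.completeSpace_coe
  have := hTc.completeSpace_coe
  have gS := apply_mem_of_flow_mem G hSc hS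
  have gT := apply_mem_of_flow_mem G hTc hT
  intro h0
  refine hz (isUnit_of_isUnit_restrict hST gS gT ?_ ?_)
  · by_contra hu
    refine absurd (re_neg_of_norm_flow_apply_le (G := G.restrict gS) hρ hC (fun x t ht => ?_) hu)
      (by simp [h0])
    rw [← Submodule.norm_coe, coe_flow_restrict G gS x ht]
    exact hS' x x.2 t ht
  · by_contra hu
    have hu' : -z ∈ spectrum ℂ (-G.restrict gT) := by
      rw [← spectrum.neg_eq, Set.neg_mem_neg]; exact hu
    refine absurd (re_neg_of_norm_flow_apply_le hρ (inv_nonneg.2 hc.le) (fun x t ht => ?_) hu')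
      (by simp [h0])
    rw [flow_neg_left]
    set y := flow (G.restrict gT) (-t) x with hy
    have hx : flow (G.restrict gT) t y = x := by
      rw [hy, ← mul_apply_eq_comp, flow_mul_neg, one_apply_eq_self]
    have h1 := hT' y y.2 t ht
    rw [← coe_flow_restrict G gT y ht, hx] at h1
    have h2 : Real.exp (-ρ * t) * Real.exp (ρ * t) = 1 := by
      rw [← Real.exp_add]; simp
    calc ‖y‖ = c⁻¹ * Real.exp (-ρ * t) * (c * Real.exp (ρ * t) * ‖y‖) := by
          have : c⁻¹ * c = 1 := inv_mul_cancel₀ hc.ne'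
          linear_combination (-‖y‖) * h2 - ‖y‖ * Real.exp (-ρ * t) * Real.exp (ρ * t) * this
      _ ≤ _ := by gcongr; exact h1

end Operator

/-! ### The generator of a regular pencil and its classical solutions -/

section Pencil

variable {H : Type*} [NormedAddCommGroup H] [InnerProductSpace ℂ H] {M₀ M₁ : H →L[ℂ] H}

theorem apply_mem_range_of_mem_IV {x : H} (hx : x ∈ IV M₀ M₁) : ∃ w, M₀ w = M₁ x := hx

theorem isClosed_IV (hclosed : IsClosed (LinearMap.range (M₀ : H →ₗ[ℂ] H) : Set H)) :
    IsClosed (IV M₀ M₁ : Set H) := hclosed.preimage M₁.continuous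

/-- Regularity of the pencil along the positive real axis: the operators `R r = (r M₀ + M₁)⁻¹` are
uniformly bounded for large real `r`. -/
theorem IsRegularPencil.exists_resolvent (hreg : IsRegularPencil M₀ M₁) :
    ∃ (R : ℝ → H →L[ℂ] H) (C : ℝ), 0 ≤ C ∧ ∀ᶠ r : ℝ in atTop, (∀ x, ‖R r x‖ ≤ C * ‖x‖) ∧
      (∀ x, r • M₀ (R r x) + M₁ (R r x) = x) ∧ ∀ x, R r (r • M₀ x + M₁ x) = x := by
  obtain ⟨ν, hν, C, hC⟩ := hreg
  have hC0 : 0 ≤ C := (norm_nonneg _).trans (hC ((ν + 1 : ℝ) : ℂ) (by simp))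
  refine ⟨fun r => Ring.inverse (pencil M₀ M₁ r), C, hC0, ?_⟩
  filter_upwards [eventually_gt_atTop ν] with r hr
  have hu : IsUnit (pencil M₀ M₁ r) := by
    have := hν (show (r : ℂ) ∈ {z : ℂ | ν < z.re} by simpa using hr)
    simpa [pencilSpectrum, spectrum.zero_mem_iff] using this
  have hp : ∀ x, pencil M₀ M₁ r x = r • M₀ x + M₁ x := fun x => by
    rw [← Complex.coe_smul]; rfl
  refine ⟨fun x => ?_, fun x => ?_, fun x => ?_⟩
  · exact ContinuousLinearMap.le_of_opNorm_le _ (hC r (by simpa using hr)) x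
  · rw [← hp, ← mul_apply_eq_comp, Ring.mul_inverse_cancel _ hu, one_apply_eq_self]
  · rw [← hp, ← mul_apply_eq_comp, Ring.inverse_mul_cancel _ hu, one_apply_eq_self]

section Resolvent

variable {R : ℝ → H →L[ℂ] H} {C : ℝ}
  (hR : ∀ᶠ r : ℝ in atTop, (∀ x, ‖R r x‖ ≤ C * ‖x‖) ∧
      (∀ x, r • M₀ (R r x) + M₁ (R r x) = x) ∧ ∀ x, R r (r • M₀ x + M₁ x) = x)

include hR

theorem eventually_smul_resolvent_apply (y : H) :
    ∀ᶠ r : ℝ in atTop, r • R r (M₀ y) = y - R r (M₁ y) := by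
  filter_upwards [hR] with r ⟨_, _, h⟩
  have h' := h y
  rw [map_add, ← Complex.coe_smul, map_smul, Complex.coe_smul] at h'
  exact eq_sub_of_add_eq h'

/-- On the range of `M₀` the resolvent is of order `1 / r`. -/
theorem tendsto_resolvent_apply (y : H) : Tendsto (fun r => R r (M₀ y)) atTop (𝓝 0) := by
  refine squeeze_zero_norm' (a := fun r => r⁻¹ * (‖y‖ + C * ‖M₁ y‖)) ?_ ?_
  · filter_upwards [hR, eventually_smul_resolvent_apply hR y, eventually_gt_atTop 0]
      with r ⟨h, _⟩ h' hr
    rw [← inv_smul_smul₀ hr.ne' (R r (M₀ y)), h', norm_smul, norm_inv, Real.norm_of_nonneg hr.le]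
    gcongr
    exact (norm_sub_le _ _).trans (by gcongr; exact h _)
  · simpa using tendsto_inv_atTop_zero.mul_const (‖y‖ + C * ‖M₁ y‖)

/-- `M₀` is bounded below on `IV`: for `x ∈ IV` the vectors `r R(r) M₀ x` converge to `x`, and they
depend on `M₀ x` only, whence they are controlled by a preimage of `M₀ x` of minimal size. -/
theorem exists_norm_le_of_mem_IV [CompleteSpace H]
    (hclosed : IsClosed (LinearMap.range (M₀ : H →ₗ[ℂ] H) : Set H)) (hC : 0 ≤ C) :
    ∃ K : ℝ, 0 ≤ K ∧ ∀ x ∈ IV M₀ M₁, ‖x‖ ≤ K * ‖M₀ x‖ := by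
  have : CompleteSpace (LinearMap.range (M₀ : H →ₗ[ℂ] H)) := hclosed.completeSpace_coe
  obtain ⟨K, hK, h⟩ := M₀.rangeRestrict.exists_preimage_norm_le fun ⟨y, x, hx⟩ =>
    ⟨x, Subtype.ext hx⟩
  refine ⟨(1 + C * ‖M₁‖) * K, by positivity, fun x hx => ?_⟩
  obtain ⟨w, hw⟩ := apply_mem_range_of_mem_IV hx
  obtain ⟨y, hy, hyK⟩ := h ⟨M₀ x, x, rfl⟩
  have hy' : M₀ y = M₀ x := congrArg Subtype.val hy
  have hlim : Tendsto (fun r : ℝ => r • R r (M₀ x)) atTop (𝓝 x) := by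
    have h1 := (tendsto_resolvent_apply hR w).const_sub x
    rw [sub_zero, hw] at h1
    exact h1.congr' ((eventually_smul_resolvent_apply hR x).mono fun r h => h.symm)
  refine le_of_tendsto hlim.norm ?_
  filter_upwards [hR, eventually_smul_resolvent_apply hR y] with r ⟨h, _⟩ h'
  rw [show r • R r (M₀ x) = y - R r (M₁ y) by rw [← hy', h']]
  calc ‖y - R r (M₁ y)‖ ≤ ‖y‖ + C * (‖M₁‖ * ‖y‖) :=
        (norm_sub_le _ _).trans (by gcongr; exact (h _).trans (by gcongr; exact M₁.le_opNorm y))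
    _ = (1 + C * ‖M₁‖) * ‖y‖ := by ring
    _ ≤ (1 + C * ‖M₁‖) * (K * ‖M₀ x‖) := by gcongr; exact hyK
    _ = _ := by ring

/-- Every element of the range of `M₀` is a limit of values of `M₀` on `IV`, namely of
`M₀ (r R(r) M₀ y)`. -/
theorem denseRange_restrM₀ : DenseRange (restrM₀ M₀ M₁) := by
  rintro ⟨_, y, rfl⟩
  have hmem : ∀ᶠ r : ℝ in atTop, r • R r (M₀ y) ∈ IV M₀ M₁ := by
    filter_upwards [hR] with r ⟨_, h, _⟩
    refine ⟨r • (y - r • R r (M₀ y)), ?_⟩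
    have := h (M₀ y)
    simp only [ContinuousLinearMap.coe_coe, ← Complex.coe_smul, map_smul, map_sub] at this ⊢
    rw [sub_eq_of_eq_add' this.symm]
  have hlim : Tendsto (fun r : ℝ => M₀ (r • R r (M₀ y))) atTop (𝓝 (M₀ y)) := by
    have h1 := ((M₁.continuous.tendsto 0).comp (tendsto_resolvent_apply hR y)).const_sub (M₀ y)
    rw [map_zero, sub_zero] at h1
    refine h1.congr' ?_
    filter_upwards [hR] with r ⟨_, h, _⟩
    have := h (M₀ y)
    simp only [Function.comp_apply, ← Complex.coe_smul, map_smul] at this ⊢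
    rw [sub_eq_of_eq_add this.symm]
  rw [closure_subtype]
  refine mem_closure_of_tendsto hlim ?_
  filter_upwards [hmem] with r hr
  exact ⟨_, ⟨⟨_, hr⟩, rfl⟩, rfl⟩

end Resolvent

variable [CompleteSpace H]

theorem restrM₀_bijective (hclosed : IsClosed (LinearMap.range (M₀ : H →ₗ[ℂ] H) : Set H))
    (hreg : IsRegularPencil M₀ M₁) : Function.Bijective (restrM₀ M₀ M₁) := by
  obtain ⟨R, C, hC, hR⟩ := hreg.exists_resolvent
  obtain ⟨K, hK, h⟩ := exists_norm_le_of_mem_IV hR hclosed hC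
  have : CompleteSpace (IV M₀ M₁) := (isClosed_IV hclosed).completeSpace_coe
  have ha : AntilipschitzWith ⟨K, hK⟩ (restrM₀ M₀ M₁) :=
    (restrM₀ M₀ M₁).antilipschitz_of_bound fun x => h x x.2
  refine ⟨ha.injective, range_eq_univ.1 ?_⟩
  rw [← (denseRange_restrM₀ hR).closure_range]
  exact (ha.isClosed_range (restrM₀ M₀ M₁).uniformContinuous).closure_eq.symm

/-- The defining property of the generator, which determines it: `M₀ (G x) = - M₁ x`. -/
theorem eq_generatorIV_iff (hclosed : IsClosed (LinearMap.range (M₀ : H →ₗ[ℂ] H) : Set H))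
    (hreg : IsRegularPencil M₀ M₁) (x w : IV M₀ M₁) :
    w = generatorIV M₀ M₁ x ↔ M₀ w + M₁ x = 0 := by
  have : CompleteSpace (IV M₀ M₁) := (isClosed_IV hclosed).completeSpace_coe
  have : CompleteSpace (LinearMap.range (M₀ : H →ₗ[ℂ] H)) := hclosed.completeSpace_coe
  have hb := restrM₀_bijective hclosed hreg
  set e := ContinuousLinearEquiv.ofBijective (restrM₀ M₀ M₁) (LinearMap.ker_eq_bot.2 hb.1)
    (LinearMap.range_eq_top.2 hb.2)
  have he : (restrM₀ M₀ M₁).inverse = (e.symm : _ →L[ℂ] IV M₀ M₁) :=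
    ContinuousLinearMap.inverse_equiv e
  have hG : generatorIV M₀ M₁ x = e.symm (-restrM₁ M₀ M₁ x) := by
    rw [generatorIV, he, map_neg]; rfl
  rw [hG, ContinuousLinearEquiv.eq_symm_apply, ← add_eq_zero_iff_eq_neg, Subtype.ext_iff]
  rfl

/-- The classical solutions starting in `IV` are the orbits of the group of the generator: a
solution stays in the closed space `IV`, so its derivative belongs to `IV` as well. -/
theorem IsStrongSolution.eq_flow
    (hclosed : IsClosed (LinearMap.range (M₀ : H →ₗ[ℂ] H) : Set H)) (hreg : IsRegularPencil M₀ M₁)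
    {u₀ : IV M₀ M₁} {u : ℝ → H} (hu : IsStrongSolution M₀ M₁ u₀ u) {t : ℝ} (ht : 0 ≤ t) :
    u t = flow (generatorIV M₀ M₁) t u₀ := by
  have : CompleteSpace (IV M₀ M₁) := (isClosed_IV hclosed).completeSpace_coe
  set P : H →L[ℂ] IV M₀ M₁ := (IV M₀ M₁).orthogonalProjectionOnto
  have hP : ∀ x ∈ IV M₀ M₁, (P x : H) = x := fun x hx =>
    congrArg Subtype.val
      (Submodule.orthogonalProjectionOnto_mem_subspace_eq_self (⟨x, hx⟩ : IV M₀ M₁))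
  have hmem : ∀ t, 0 ≤ t → u t ∈ IV M₀ M₁ := by
    intro t ht
    rcases ht.eq_or_lt with rfl | ht
    · rw [hu.initial]; exact u₀.2
    · refine ⟨-deriv u t, ?_⟩
      have := hu.equation t ht
      rw [map_neg, neg_eq_iff_add_eq_zero]
      exact this
  have hd : ∀ t, 0 < t → HasDerivAt (fun s => P (u s)) (generatorIV M₀ M₁ (P (u t))) t := by
    intro t ht
    have h1 : HasDerivAt u (deriv u t) t :=
      ((hu.contDiffOn.differentiableOn one_ne_zero).differentiableAt (Ioi_mem_nhds ht)).hasDerivAt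
    have h2 : HasDerivAt (fun s => P (u s)) (P (deriv u t)) t :=
      (P.restrictScalars ℝ).hasFDerivAt.comp_hasDerivAt t h1
    have h3 : HasDerivAt (fun s => (P (u s) : H)) (P (deriv u t)) t :=
      ((IV M₀ M₁).subtypeL.restrictScalars ℝ).hasFDerivAt.comp_hasDerivAt t h2
    have h4 : (P (deriv u t) : H) = deriv u t := by
      refine h3.unique (h1.congr_of_eventuallyEq ?_)
      filter_upwards [Ioi_mem_nhds ht] with s hs using hP _ (hmem s (le_of_lt hs))
    rwa [(eq_generatorIV_iff hclosed hreg (P (u t)) (P (deriv u t))).2] at h2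
    rw [h4, hP _ (hmem t ht.le)]
    exact hu.equation t ht
  have h0 : P (u 0) = u₀ := Subtype.ext (by rw [hP _ (hmem 0 le_rfl), hu.initial])
  rw [← hP _ (hmem t ht), eq_flow_of_hasDerivAt (generatorIV M₀ M₁) (u := fun s => P (u s))
    (P.continuous.comp_continuousOn hu.continuousOn) hd ht, h0]

theorem isStrongSolution_flow
    (hclosed : IsClosed (LinearMap.range (M₀ : H →ₗ[ℂ] H) : Set H)) (hreg : IsRegularPencil M₀ M₁)
    (u₀ : IV M₀ M₁) :
    IsStrongSolution M₀ M₁ u₀ fun t => (flow (generatorIV M₀ M₁) t u₀ : H) := by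
  have : CompleteSpace (IV M₀ M₁) := (isClosed_IV hclosed).completeSpace_coe
  set G := generatorIV M₀ M₁
  have hd : ∀ t, HasDerivAt (fun t => (flow G t u₀ : H)) (G (flow G t u₀) : IV M₀ M₁) t := fun t =>
    ((IV M₀ M₁).subtypeL.restrictScalars ℝ).hasFDerivAt.comp_hasDerivAt t
      (hasDerivAt_flow_apply G u₀ t)
  have hderiv : deriv (fun t => (flow G t u₀ : H)) = fun t => (G (flow G t u₀) : H) :=
    funext fun t => (hd t).deriv
  have hcont : Continuous fun t => flow G t u₀ := (continuous_flow G).clm_apply continuous_const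
  refine ⟨(continuous_subtype_val.comp hcont).continuousOn, ContDiff.contDiffOn ?_,
    fun t _ => ?_, by simp⟩
  · rw [contDiff_one_iff_deriv, hderiv]
    exact ⟨fun t => (hd t).differentiableAt, continuous_subtype_val.comp (G.continuous.comp hcont)⟩
  · rw [hderiv]
    exact (eq_generatorIV_iff hclosed hreg (flow G t u₀) _).1 rfl

end Pencil

/-! ### Dichotomy and stability of the pencil -/

section Dichotomy

variable {H : Type*} [NormedAddCommGroup H] [InnerProductSpace ℂ H] [CompleteSpace H]
  {M₀ M₁ : H →L[ℂ] H}

/-- A dichotomy of the pencil is a dichotomy of the group on `IV`. -/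
theorem IsStrongDichotomy.re_ne_zero
    (hclosed : IsClosed (LinearMap.range (M₀ : H →ₗ[ℂ] H) : Set H)) (hreg : IsRegularPencil M₀ M₁)
    {S T : Submodule ℂ H} (h : IsStrongDichotomy M₀ M₁ S T) {z : ℂ} (hz : z ∈ spectrumIV M₀ M₁) :
    z.re ≠ 0 := by
  have : CompleteSpace (IV M₀ M₁) := (isClosed_IV hclosed).completeSpace_coe
  have hS : S ≤ IV M₀ M₁ := h.sup_eq ▸ le_sup_left
  have hT : T ≤ IV M₀ M₁ := h.sup_eq ▸ le_sup_right
  obtain ⟨ρ, hρ, C, hC, c, hc, h₁, h₂⟩ := h.bounds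
  have hsol := isStrongSolution_flow hclosed hreg
  have hcompl : IsCompl (S.comap (IV M₀ M₁).subtype) (T.comap (IV M₀ M₁).subtype) := by
    constructor
    · rw [Submodule.disjoint_def]
      intro x hx hx'
      have : (x : H) ∈ S ⊓ T := ⟨hx, hx'⟩
      rw [h.inf_eq] at this
      exact Subtype.ext this
    · rw [codisjoint_iff, eq_top_iff]
      rintro ⟨x, hx⟩ -
      have hx' := hx
      rw [← h.sup_eq] at hx'
      obtain ⟨s, hs, t, ht, rfl⟩ := Submodule.mem_sup.1 hx'
      exact Submodule.mem_sup.2 ⟨⟨s, hS hs⟩, hs, ⟨t, hT ht⟩, ht, rfl⟩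
  exact re_ne_zero_of_dichotomy hcompl
    (h.isClosed_left.preimage continuous_subtype_val)
    (h.isClosed_right.preimage continuous_subtype_val)
    (fun x hx t ht => h.invariant_left x hx _ (hsol x) t ht)
    (fun x hx t ht => h.invariant_right x hx _ (hsol x) t ht) hρ hC hc
    (fun x hx t ht => h₁ x hx _ (hsol x) t ht) (fun x hx t ht => h₂ x hx _ (hsol x) t ht) hz

theorem isInvariant_map (hclosed : IsClosed (LinearMap.range (M₀ : H →ₗ[ℂ] H) : Set H))
    (hreg : IsRegularPencil M₀ M₁) {S : Submodule ℂ (IV M₀ M₁)}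
    (hS : ∀ x ∈ S, ∀ t : ℝ, flow (generatorIV M₀ M₁) t x ∈ S) :
    IsInvariant M₀ M₁ (S.map (IV M₀ M₁).subtype) := by
  rintro _ ⟨x, hx, rfl⟩ u hu t ht
  rw [hu.eq_flow hclosed hreg ht.le]
  exact ⟨_, hS x hx t, rfl⟩

/-- If the spectrum of the generator misses the imaginary axis, the range and the kernel of its
spectral projection for the left half-plane form a dichotomy. -/
theorem admitsStrongDichotomy_of_re_ne_zero
    (hclosed : IsClosed (LinearMap.range (M₀ : H →ₗ[ℂ] H) : Set H)) (hreg : IsRegularPencil M₀ M₁)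
    (h : ∀ z ∈ spectrumIV M₀ M₁, z.re ≠ 0) : AdmitsStrongDichotomy M₀ M₁ := by
  have hIV := isClosed_IV (M₁ := M₁) hclosed
  have : CompleteSpace (IV M₀ M₁) := hIV.completeSpace_coe
  set G := generatorIV M₀ M₁
  obtain ⟨p, hp, hpG, ρ, hρ, C, hC, hb⟩ := exists_projection_flow_decay (G := G) h
  have hpp : ∀ x, p (p x) = p x := fun x => by rw [← mul_apply_eq_comp, hp]
  have hcomm : ∀ t x, p (flow G t x) = flow G t (p x) := fun t x => by
    rw [← mul_apply_eq_comp, (commute_flow hpG t).eq, mul_apply_eq_comp]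
  set S := LinearMap.ker ((1 - p : IV M₀ M₁ →L[ℂ] IV M₀ M₁) : IV M₀ M₁ →ₗ[ℂ] IV M₀ M₁)
  set T := LinearMap.ker (p : IV M₀ M₁ →ₗ[ℂ] IV M₀ M₁)
  have hS : ∀ x, x ∈ S ↔ p x = x := fun x => by
    simp only [S, LinearMap.mem_ker, ContinuousLinearMap.coe_coe, sub_apply, one_apply_eq_self]
    rw [sub_eq_zero, eq_comm]
  have hT : ∀ x, x ∈ T ↔ p x = 0 := fun x => Iff.rfl
  have hclosedMap : ∀ {V : Submodule ℂ (IV M₀ M₁)}, IsClosed (V : Set (IV M₀ M₁)) →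
      IsClosed ((V.map (IV M₀ M₁).subtype : Submodule ℂ H) : Set H) := fun hV =>
    hIV.isClosedEmbedding_subtypeVal.isClosedMap _ hV
  refine ⟨S.map (IV M₀ M₁).subtype, T.map (IV M₀ M₁).subtype, ?_⟩
  refine ⟨hclosedMap (ContinuousLinearMap.isClosed_ker _),
    hclosedMap (ContinuousLinearMap.isClosed_ker _), ?_, ?_,
    isInvariant_map hclosed hreg fun x hx t => ?_, isInvariant_map hclosed hreg fun x hx t => ?_,
    ρ, hρ, C, hC.le, C⁻¹, inv_pos.2 hC, ?_, ?_⟩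
  · rw [← Submodule.map_inf _ Subtype.val_injective, show S ⊓ T = ⊥ from ?_, Submodule.map_bot]
    refine (Submodule.eq_bot_iff _).2 fun x hx => ?_
    rw [← (hS x).1 hx.1, (hT x).1 hx.2]
  · rw [← Submodule.map_sup, show S ⊔ T = ⊤ from ?_, Submodule.map_subtype_top]
    refine eq_top_iff.2 fun x _ => Submodule.mem_sup.2 ⟨p x, (hS _).2 (hpp x), x - p x, ?_, by simp⟩
    rw [hT, map_sub, hpp, sub_self]
  · rw [hS] at hx ⊢
    rw [hcomm, hx]
  · rw [hT] at hx ⊢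
    rw [hcomm, hx, map_zero]
  · rintro _ ⟨x, hx, rfl⟩ u hu t ht
    rw [hu.eq_flow hclosed hreg ht]
    have h1 : flow G t x = (flow G t * p) x := by rw [mul_apply_eq_comp, (hS x).1 hx]
    rw [Submodule.norm_coe, h1]
    exact ContinuousLinearMap.le_of_opNorm_le _ (hb t ht).1 x
  · rintro _ ⟨x, hx, rfl⟩ u hu t ht
    rw [hu.eq_flow hclosed hreg ht]
    have h1 : x = (flow G (-t) * (1 - p)) (flow G t x) := by
      rw [mul_apply_eq_comp, sub_apply, one_apply_eq_self, hcomm, (hT x).1 hx, map_zero, sub_zero,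
        ← mul_apply_eq_comp, flow_neg_mul, one_apply_eq_self]
    have h2 : ‖x‖ ≤ C * Real.exp (-ρ * t) * ‖flow G t x‖ := by
      conv_lhs => rw [h1]
      exact ContinuousLinearMap.le_of_opNorm_le _ (hb t ht).2 _
    have h3 : Real.exp (ρ * t) * Real.exp (-ρ * t) = 1 := by rw [← Real.exp_add]; simp
    have h4 : C⁻¹ * C = 1 := inv_mul_cancel₀ hC.ne'
    change C⁻¹ * Real.exp (ρ * t) * ‖x‖ ≤ ‖flow G t x‖
    calc C⁻¹ * Real.exp (ρ * t) * ‖x‖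
        ≤ C⁻¹ * Real.exp (ρ * t) * (C * Real.exp (-ρ * t) * ‖flow G t x‖) := by gcongr
      _ = ‖flow G t x‖ := by
        linear_combination ‖flow G t x‖ * h3 +
          ‖flow G t x‖ * Real.exp (ρ * t) * Real.exp (-ρ * t) * h4

theorem isStronglyStable_iff
    (hclosed : IsClosed (LinearMap.range (M₀ : H →ₗ[ℂ] H) : Set H)) (hreg : IsRegularPencil M₀ M₁) :
    IsStronglyStable M₀ M₁ ↔ ∀ z ∈ spectrumIV M₀ M₁, z.re < 0 := by
  have hIV := isClosed_IV (M₁ := M₁) hclosed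
  have : CompleteSpace (IV M₀ M₁) := hIV.completeSpace_coe
  set G := generatorIV M₀ M₁
  constructor
  · intro h z hz
    obtain ⟨ρ, hρ, C, hC, -, -, h₁, -⟩ := h.bounds
    exact re_neg_of_norm_flow_apply_le (G := G) hρ hC
      (fun x t ht => h₁ x x.2 _ (isStrongSolution_flow hclosed hreg x) t ht) hz
  · intro h
    obtain ⟨ρ, hρ, C, hC, hb⟩ := exists_flow_decay (G := G) h
    refine ⟨hIV, isClosed_singleton, inf_bot_eq _, sup_bot_eq _, fun x hx u hu t ht => ?_,
      fun x hx u hu t ht => ?_, ρ, hρ, C, hC, 1, one_pos, fun x hx u hu t ht => ?_,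
      fun x hx u hu t ht => ?_⟩
    · rw [IsStrongSolution.eq_flow hclosed hreg (u₀ := ⟨x, hx⟩) hu ht.le]
      exact Subtype.property _
    · rw [(Submodule.mem_bot ℂ).1 hx] at hu
      rw [IsStrongSolution.eq_flow hclosed hreg (u₀ := 0) hu ht.le, map_zero]
      exact zero_mem _
    · rw [IsStrongSolution.eq_flow hclosed hreg (u₀ := ⟨x, hx⟩) hu ht]
      exact ContinuousLinearMap.le_of_opNorm_le _ (hb t ht) (⟨x, hx⟩ : IV M₀ M₁)
    · rw [(Submodule.mem_bot ℂ).1 hx, norm_zero, mul_zero]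
      exact norm_nonneg _

end Dichotomy

end DAE

theorem mainTheorem5 {H : Type*} [NormedAddCommGroup H] [InnerProductSpace ℂ H] [CompleteSpace H]
    (M₀ M₁ : H →L[ℂ] H)
    (hclosed : IsClosed (LinearMap.range (M₀ : H →ₗ[ℂ] H) : Set H))
    (hreg : DAE.IsRegularPencil M₀ M₁) :
    (DAE.AdmitsStrongDichotomy M₀ M₁ ↔
      DAE.spectrumIV M₀ M₁ ∩ {z : ℂ | z.re = 0} = ∅) ∧
    (DAE.IsStronglyStable M₀ M₁ ↔
      DAE.spectrumIV M₀ M₁ ⊆ {z : ℂ | z.re < 0}) := by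
  refine ⟨?_, DAE.isStronglyStable_iff hclosed hreg⟩
  rw [← Set.disjoint_iff_inter_eq_empty, Set.disjoint_left]
  exact ⟨fun ⟨S, T, h⟩ z hz => h.re_ne_zero hclosed hreg hz,
    DAE.admitsStrongDichotomy_of_re_ne_zero hclosed hreg⟩
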